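/- Let $B$ and $D$ be (complex, not necessarily unital) C*-algebras and let $\pi\colon B\to D$ be a surjective $*$-homomorphism. Then there is a norm-continuous map $s\colon D\to B$ (not necessarily linear) with $\pi(s(d))=d$ for all $d\in D$ which is 1. contractive: $\|s(d)\|\le\|d\|$ for all $d\in D$; moreover, if $D\neq 0$, then $s$ has norm exactly $1$, i.e. $1$ is the least real number $C$ such that $\|s(d)\|\le C\|d\|$ for all $d\in D$; 2. unital if $\pi$ is unital: if $B$ and $D$ are unital, $D\ne 0$ and $\pi(1_B)=1_D$, then $s(1_D)=1_B$; 3. selfadjoint: $s(d^*)=s(d)^*$ for all $d\in D$; 4. positive: $s(d)\ge 0$ whenever $d\ge 0$. Moreover, let $G$ be a compact topological group acting on $B$ and on $D$ by $*$-automorphisms such that the orbit maps $g\mapsto g\cdot b$ and $g\mapsto g\cdot d$ are norm-continuous for all $b\in B$, $d\in D$, and suppose that $\pi(g\cdot b)=g\cdot\pi(b)$ for all $g\in G$, $b\in B$. Then there is a continuous section $s$ of $\pi$ with all the properties 1--4 which is also equivariant: $s(g\cdot d)=g\cdot s(d)$ for all $g\in G$, $d\in D$. -/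

import Mathlib

/-- `e` is the (two-sided) identity element of the possibly non-unital algebra `A`. An algebra is
unital when such an `e` exists; it is then unique. -/
def IsIdentityElement {A : Type*} [Mul A] (e : A) : Prop :=
  ∀ a : A, e * a = a ∧ a * e = a

/-- An action of a topological group `G` on a C⋆-algebra `A` by ⋆-automorphisms makes `A` a
`G`-algebra when all orbit maps `g ↦ g • a` are norm-continuous (`A` has the norm topology). -/
def IsGAlgebraAction {G A : Type*} [Group G] [TopologicalSpace G] [NonUnitalCStarAlgebra A]
    (α : G →* (A ≃⋆ₐ[ℂ] A)) : Prop :=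
  ∀ a : A, Continuous fun g : G => α g a

/-- `s : D → B` (a map of sets, not assumed linear) is a continuous section of `π : B → D` that is
contractive, of norm exactly one, unital if `π` is unital, selfadjoint and positive. -/
structure IsContractivePositiveSection {B D : Type*}
    [NonUnitalCStarAlgebra B] [PartialOrder B] [NonUnitalCStarAlgebra D] [PartialOrder D]
    (π : B →⋆ₙₐ[ℂ] D) (s : D → B) : Prop where
  /-- `s` is a section of `π`. -/
  isSection : ∀ d : D, π (s d) = d
  /-- `s` is norm-continuous. -/
  continuous : Continuous s
  /-- `s` is contractive. -/
  contractive : ∀ d : D, ‖s d‖ ≤ ‖d‖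
  /-- If `D ≠ 0`, the norm of `s`, the least `C` with `‖s d‖ ≤ C ‖d‖` for all `d`, equals one. -/
  norm_eq_one : Nontrivial D → IsLeast {C : ℝ | ∀ d : D, ‖s d‖ ≤ C * ‖d‖} 1
  /-- If `B` and `D` are unital, `D ≠ 0` and `π 1 = 1`, then `s 1 = 1`. -/
  unital : Nontrivial D → ∀ (e : B) (f : D), IsIdentityElement e → IsIdentityElement f →
    π e = f → s f = e
  /-- `s` is selfadjoint. -/
  selfadjoint : ∀ d : D, s (star d) = star (s d)
  /-- `s` is positive. -/
  positive : ∀ d : D, 0 ≤ d → 0 ≤ s d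

/-! Bartle–Graves gives a continuous section `t`: approximate lifts patched from local constants are
corrected by a geometric series. Each further property comes from an operation that keeps
continuity, lifting and what was already gained. Corrections in the kernel of `π` fix the values at
0 and at the identity. Then |t(|d|)| + t(d - |d|) is a lift, since ⋆-homomorphisms preserve absolute
values, and is positive for d ≥ 0. Truncating t(d)/‖d‖ to the unit ball by functional calculus and
rescaling gives contractivity; averaging with d ↦ t(d*)* gives selfadjointness. For compact G, the
Haar average of g·t(g⁻¹·d) keeps these properties, and left invariance makes it equivariant. -/

open Filter Topology Set

/-! ### Bartle–Graves selection -/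

/-- A bounded linear surjection of Banach spaces admits continuous approximate lifts of continuous
maps, with linear control on the size of the lift. -/
theorem exists_continuous_approx_lift {X E F : Type*} [MetricSpace X]
    [NormedAddCommGroup E] [NormedSpace ℝ E] [NormedAddCommGroup F] [NormedSpace ℝ F]
    (π : E →L[ℝ] F) {C : ℝ} (hC : 0 < C) (hπ : ∀ y, ∃ x, π x = y ∧ ‖x‖ ≤ C * ‖y‖)
    {ε : ℝ} (hε : 0 < ε) (f : X → F) (hf : Continuous f) :
    ∃ g : C(X, E), ∀ x, ‖f x - π (g x)‖ < ε ∧ ‖g x‖ < C * (‖f x‖ + ε) := by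
  let t : X → Set E := fun x => {b | ‖f x - π b‖ < ε ∧ ‖b‖ < C * (‖f x‖ + ε)}
  refine exists_continuous_forall_mem_convex_of_local_const (t := t) (fun x => ?_) fun x => ?_
  · have h1 : Convex ℝ {b : E | ‖f x - π b‖ < ε} := by
      have := (convex_ball (f x) ε).linear_preimage π.toLinearMap
      convert this using 1
      ext b
      simp [dist_eq_norm, norm_sub_rev]
    have h2 : Convex ℝ {b : E | ‖b‖ < C * (‖f x‖ + ε)} := by
      convert convex_ball (0 : E) (C * (‖f x‖ + ε)) using 1
      ext b
      simp
    exact h1.inter h2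
  -- One exact lift of `f x` stays admissible near `x`, both conditions being strict; the slack `ε`
  -- secures this even when `f x = 0`.
  · obtain ⟨b, hb, hbn⟩ := hπ (f x)
    refine ⟨b, ?_⟩
    have c1 : Continuous fun y => ‖f y - π b‖ := by fun_prop
    have c2 : Continuous fun y => C * (‖f y‖ + ε) := by fun_prop
    have e1 : ∀ᶠ y in 𝓝 x, ‖f y - π b‖ < ε :=
      c1.continuousAt.eventually_lt continuousAt_const (by simpa [hb] using hε)
    have e2 : ∀ᶠ y in 𝓝 x, ‖b‖ < C * (‖f y‖ + ε) :=
      continuousAt_const.eventually_lt c2.continuousAt (by nlinarith)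
    exact e1.and e2

/-- **Bartle–Graves**: a bounded linear surjection of Banach spaces has a continuous section. -/
theorem exists_continuous_section {E F : Type*}
    [NormedAddCommGroup E] [NormedSpace ℝ E] [CompleteSpace E]
    [NormedAddCommGroup F] [NormedSpace ℝ F] [CompleteSpace F]
    (π : E →L[ℝ] F) (hπ : Function.Surjective π) :
    ∃ s : F → E, Continuous s ∧ ∀ y, π (s y) = y := by
  obtain ⟨C, hC, hpre⟩ := π.exists_preimage_norm_le hπ
  have hε : ∀ n : ℕ, (0 : ℝ) < (1 / 2) ^ n := fun n => by positivity
  choose L hL using fun (n : ℕ) (f : C(F, F)) =>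
    exists_continuous_approx_lift π hC hpre (hε n) f f.continuous
  let πC : C(E, F) := ⟨π, π.continuous⟩
  -- `f n` is the residual left after `n` corrections, and `g n` its approximate lift.
  let f : ℕ → C(F, F) := fun n => Nat.rec (ContinuousMap.id F) (fun n f => f - πC.comp (L n f)) n
  let g : ℕ → C(F, E) := fun n => L n (f n)
  have hf0 : ∀ y, f 0 y = y := fun y => rfl
  have hfs : ∀ n y, f (n + 1) y = f n y - π (g n y) := fun n y => rfl
  have hfn : ∀ n y, ‖f (n + 1) y‖ ≤ (1 / 2) ^ n := fun n y => by
    rw [hfs]; exact (hL n (f n) y).1.le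
  -- The shift is needed: `g 0` has no bound uniform in `y`. From index 1 on, residual and tolerance
  -- are each at most `(1 / 2) ^ n`, whence `2 * C`.
  have hgn : ∀ n y, ‖g (n + 1) y‖ ≤ 2 * C * (1 / 2) ^ n := fun n y => by
    have h1 := (hL (n + 1) (f (n + 1)) y).2.le
    have h2 := hfn n y
    refine h1.trans ?_
    have : (1 / 2 : ℝ) ^ (n + 1) ≤ (1 / 2) ^ n := by
      rw [pow_succ]; linarith [hε n]
    nlinarith
  have hsum : Summable fun n : ℕ => 2 * C * (1 / 2 : ℝ) ^ n :=
    (summable_geometric_of_lt_one (by norm_num) (by norm_num)).mul_left _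
  have hcont : Continuous fun y => ∑' n, g (n + 1) y :=
    continuous_tsum (fun n => (g (n + 1)).continuous) hsum hgn
  refine ⟨fun y => g 0 y + ∑' n, g (n + 1) y, (g 0).continuous.add hcont, fun y => ?_⟩
  have hsy : Summable fun n => g (n + 1) y := hsum.of_norm_bounded fun n => hgn n y
  have hsy' : Summable fun n => g n y := (summable_nat_add_iff 1).1 hsy
  have htot : ∑' n, g n y = g 0 y + ∑' n, g (n + 1) y := hsy'.tsum_eq_zero_add
  beta_reduce
  rw [← htot]
  have h1 : Tendsto (fun n => π (∑ i ∈ Finset.range n, g i y)) atTop (𝓝 (π (∑' n, g n y))) :=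
    (π.continuous.tendsto _).comp hsy'.hasSum.tendsto_sum_nat
  have h2 : ∀ n, π (∑ i ∈ Finset.range n, g i y) = y - f n y := by
    intro n
    induction n with
    | zero => simp [hf0]
    | succ n ih => rw [Finset.sum_range_succ, map_add, ih, hfs]; abel
  have h3 : Tendsto (fun n => f n y) atTop (𝓝 0) := by
    rw [← tendsto_add_atTop_iff_nat 1]
    exact squeeze_zero_norm (fun n => hfn n y)
      (tendsto_pow_atTop_nhds_zero_of_lt_one (by norm_num) (by norm_num))
  simp only [h2] at h1
  exact tendsto_nhds_unique h1 (by simpa using tendsto_const_nhds.sub h3)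

/-! ### Truncation to the unit ball -/

/-- The continuous function `t ↦ 1 - 1 / max 1 √t`, which vanishes on `[0, 1]`. -/
noncomputable def excessFun (t : ℝ) : ℝ := 1 - (max 1 (Real.sqrt t))⁻¹

theorem continuous_excessFun : Continuous excessFun := by
  unfold excessFun
  refine continuous_const.sub (Continuous.inv₀ (by fun_prop) fun t => ?_)
  exact (lt_of_lt_of_le one_pos (le_max_left _ _)).ne'

theorem excessFun_of_le_one {t : ℝ} (ht : t ≤ 1) : excessFun t = 0 := by
  have : Real.sqrt t ≤ 1 := Real.sqrt_le_one.2 ht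
  simp [excessFun, max_eq_left this]

/-- Non-unital functional calculus needs functions vanishing at 0, so the cutoff enters through its
difference from 1. -/
theorem excessFun_zero : excessFun 0 = 0 := excessFun_of_le_one zero_le_one

theorem excessFun_le_one (t : ℝ) : excessFun t ≤ 1 := by
  have : (0 : ℝ) ≤ (max 1 (Real.sqrt t))⁻¹ :=
    inv_nonneg.2 (zero_le_one.trans (le_max_left _ _))
  simp only [excessFun]; linarith

theorem mul_one_sub_excessFun_sq_le {t : ℝ} (ht : 0 ≤ t) : t * (1 - excessFun t) ^ 2 ≤ 1 := by
  have h1 : (0 : ℝ) < max 1 (Real.sqrt t) := lt_of_lt_of_le one_pos (le_max_left _ _)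
  have h2 : t ≤ (max 1 (Real.sqrt t)) ^ 2 := by
    calc t = (Real.sqrt t) ^ 2 := (Real.sq_sqrt ht).symm
      _ ≤ _ := pow_le_pow_left₀ (Real.sqrt_nonneg t) (le_max_right _ _) 2
  have h3 : 1 - excessFun t = (max 1 (Real.sqrt t))⁻¹ := by simp [excessFun]
  rw [h3, inv_pow, ← div_eq_mul_inv]
  exact (div_le_one (by positivity)).2 h2

section UnitBallRetraction

variable {A : Type*} [NonUnitalCStarAlgebra A]

/-- The retraction `y ↦ y · min 1 |y|⁻¹` of a C⋆-algebra onto its closed unit ball. -/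
noncomputable def unitBallRetraction (y : A) : A := y - y * cfcₙ excessFun (star y * y)

theorem continuous_unitBallRetraction : Continuous (unitBallRetraction : A → A) := by
  have : Continuous fun y : A => cfcₙ excessFun (star y * y) :=
    Continuous.cfcₙ_of_mem_nhdsSet (s := univ) excessFun univ_mem (by fun_prop)
      (fun y => IsSelfAdjoint.star_mul_self y) continuous_excessFun.continuousOn excessFun_zero
  unfold unitBallRetraction
  fun_prop

theorem map_unitBallRetraction {B : Type*} [NonUnitalCStarAlgebra B] (π : A →⋆ₙₐ[ℂ] B) (y : A) :
    π (unitBallRetraction y) = unitBallRetraction (π y) := by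
  have hc : Continuous π := AddMonoidHomClass.continuous_of_bound π 1 fun a => by
    simpa using NonUnitalStarAlgHom.norm_apply_le π a
  have hst : π (star y * y) = star (π y) * π y := by rw [map_mul, map_star]
  have h := NonUnitalStarAlgHom.map_cfcₙ (R := ℝ) π excessFun (star y * y)
    continuous_excessFun.continuousOn excessFun_zero hc (IsSelfAdjoint.star_mul_self y)
    (hst ▸ IsSelfAdjoint.star_mul_self (π y))
  rw [unitBallRetraction, map_sub, map_mul, h, hst, unitBallRetraction]

theorem quasispectrum_star_mul_self_nonneg (y : A) : ∀ t ∈ quasispectrum ℝ (star y * y), 0 ≤ t := by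
  let _ := CStarAlgebra.spectralOrder A
  have _ := CStarAlgebra.spectralOrderedRing A
  exact quasispectrum_nonneg_of_nonneg (star y * y) (star_mul_self_nonneg y)

/-- By the C⋆-identity it suffices to bound t(1 - k(t))² by 1 on the spectrum of y*y, where k is
`excessFun`. -/
theorem norm_unitBallRetraction_le (y : A) : ‖unitBallRetraction y‖ ≤ 1 := by
  set a := star y * y with ha
  have hsa : IsSelfAdjoint a := IsSelfAdjoint.star_mul_self y
  have hk := continuous_excessFun
  have hk0 := excessFun_zero
  set c := cfcₙ excessFun a with hc
  have hcs : star c = c := (cfcₙ_predicate excessFun a : IsSelfAdjoint c)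
  have h1 : star (unitBallRetraction y) * unitBallRetraction y = a - a * c - c * a + c * a * c := by
    simp only [unitBallRetraction, star_sub, star_mul, ← ha, ← hc, hcs]
    simp only [sub_mul, mul_sub, ha, mul_assoc]
    abel
  have hid : cfcₙ (fun t : ℝ => t) a = a := cfcₙ_id' ℝ a
  have e1 : a * c = cfcₙ (fun t : ℝ => t * excessFun t) a := by
    rw [cfcₙ_mul (fun t : ℝ => t) excessFun a, hid]
  have e2 : c * a = cfcₙ (fun t : ℝ => excessFun t * t) a := by
    rw [cfcₙ_mul excessFun (fun t : ℝ => t) a, hid]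
  have e3 : c * a * c = cfcₙ (fun t : ℝ => excessFun t * t * excessFun t) a := by
    rw [cfcₙ_mul (fun t : ℝ => excessFun t * t) excessFun a (by fun_prop) (by simp), e2]
  have h2 : a - a * c - c * a + c * a * c
      = cfcₙ (fun t : ℝ => t - t * excessFun t - excessFun t * t
          + excessFun t * t * excessFun t) a := by
    rw [cfcₙ_add (fun t : ℝ => t - t * excessFun t - excessFun t * t)
        (fun t : ℝ => excessFun t * t * excessFun t) a (by fun_prop) (by simp) (by fun_prop)
        (by simp),
      cfcₙ_sub (fun t : ℝ => t - t * excessFun t) (fun t : ℝ => excessFun t * t) a (by fun_prop)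
        (by simp) (by fun_prop) (by simp),
      cfcₙ_sub (fun t : ℝ => t) (fun t : ℝ => t * excessFun t) a (by fun_prop)
        (by simp) (by fun_prop) (by simp), hid, ← e1, ← e2, ← e3]
  have h3 : ‖star (unitBallRetraction y) * unitBallRetraction y‖ ≤ 1 := by
    rw [h1, h2]
    refine norm_cfcₙ_le fun t ht => ?_
    have ht0 : 0 ≤ t := quasispectrum_star_mul_self_nonneg y t ht
    have : t - t * excessFun t - excessFun t * t + excessFun t * t * excessFun t
        = t * (1 - excessFun t) ^ 2 := by ring
    rw [this, Real.norm_of_nonneg (by positivity)]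
    exact mul_one_sub_excessFun_sq_le ht0
  rw [CStarRing.norm_star_mul_self] at h3
  nlinarith [norm_nonneg (unitBallRetraction y)]

theorem unitBallRetraction_of_norm_le {y : A} (hy : ‖y‖ ≤ 1) : unitBallRetraction y = y := by
  have : cfcₙ excessFun (star y * y) = cfcₙ (fun _ : ℝ => (0 : ℝ)) (star y * y) := by
    refine cfcₙ_congr fun t ht => excessFun_of_le_one ?_
    have h1 := NonUnitalIsometricContinuousFunctionalCalculus.norm_quasispectrum_le
      (𝕜 := ℝ) (star y * y) ht (IsSelfAdjoint.star_mul_self y)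
    rw [CStarRing.norm_star_mul_self] at h1
    have h2 := le_abs_self t
    rw [Real.norm_eq_abs] at h1
    nlinarith [norm_nonneg y]
  rw [unitBallRetraction, this, cfcₙ_const_zero ℝ, mul_zero, sub_zero]

theorem unitBallRetraction_nonneg [PartialOrder A] [StarOrderedRing A] {y : A} (hy : 0 ≤ y) :
    0 ≤ unitBallRetraction y := by
  have hsa : IsSelfAdjoint y := IsSelfAdjoint.of_nonneg hy
  have hk := continuous_excessFun
  have hk0 := excessFun_zero
  have hid : cfcₙ (fun t : ℝ => t) y = y := cfcₙ_id' ℝ y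
  have e1 : cfcₙ excessFun (star y * y) = cfcₙ (fun t : ℝ => excessFun (t * t)) y := by
    have : star y * y = cfcₙ (fun t : ℝ => t * t) y := by
      rw [cfcₙ_mul (fun t : ℝ => t) (fun t : ℝ => t) y, hid, hsa.star_eq]
    rw [this, ← cfcₙ_comp excessFun (fun t : ℝ => t * t) y hk.continuousOn]
    rfl
  have e2 : unitBallRetraction y = cfcₙ (fun t : ℝ => t - t * excessFun (t * t)) y := by
    rw [cfcₙ_sub (fun t : ℝ => t) (fun t : ℝ => t * excessFun (t * t)) y (by fun_prop) (by simp)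
      (by fun_prop) (by simp), cfcₙ_mul (fun t : ℝ => t) (fun t : ℝ => excessFun (t * t)) y
      (by fun_prop) (by simp) (by fun_prop) (by simpa using hk0), hid, ← e1, unitBallRetraction]
  rw [e2]
  refine cfcₙ_nonneg fun t ht => ?_
  have ht0 : 0 ≤ t := quasispectrum_nonneg_of_nonneg y hy t ht
  nlinarith [excessFun_le_one (t * t)]

end UnitBallRetraction

/-! ### Absolute values -/

section Abs

variable {A : Type*} [NonUnitalCStarAlgebra A] [PartialOrder A] [StarOrderedRing A]

theorem cfcAbs_eq_cfcₙ_sqrt (a : A) : CFC.abs a = cfcₙ Real.sqrt (star a * a) :=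
  CFC.sqrt_eq_real_sqrt _ (star_mul_self_nonneg a)

theorem continuous_cfcAbs : Continuous (CFC.abs : A → A) := by
  have : Continuous fun y : A => cfcₙ Real.sqrt (star y * y) :=
    Continuous.cfcₙ_of_mem_nhdsSet (s := univ) Real.sqrt univ_mem (by fun_prop)
      (fun y => IsSelfAdjoint.star_mul_self y) Real.continuous_sqrt.continuousOn Real.sqrt_zero
  simpa only [← cfcAbs_eq_cfcₙ_sqrt] using this

theorem map_cfcAbs {B : Type*} [NonUnitalCStarAlgebra B] [PartialOrder B] [StarOrderedRing B]
    (π : A →⋆ₙₐ[ℂ] B) (y : A) : π (CFC.abs y) = CFC.abs (π y) := by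
  have hc : Continuous π := AddMonoidHomClass.continuous_of_bound π 1 fun a => by
    simpa using NonUnitalStarAlgHom.norm_apply_le π a
  have hst : π (star y * y) = star (π y) * π y := by rw [map_mul, map_star]
  have h := NonUnitalStarAlgHom.map_cfcₙ (R := ℝ) π Real.sqrt (star y * y)
    Real.continuous_sqrt.continuousOn Real.sqrt_zero hc (IsSelfAdjoint.star_mul_self y)
    (hst ▸ IsSelfAdjoint.star_mul_self (π y))
  rw [cfcAbs_eq_cfcₙ_sqrt, h, hst, cfcAbs_eq_cfcₙ_sqrt]

end Abs

/-! ### Identity elements -/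

theorem IsIdentityElement.nonneg {A : Type*} [NonUnitalCStarAlgebra A] [PartialOrder A]
    [StarOrderedRing A] {e : A} (he : IsIdentityElement e) : 0 ≤ e := by
  have h : star e * e = e := by
    have h1 := (he (star e)).2
    have h2 := congrArg star h1
    rw [star_mul, star_star, h1] at h2
    rw [h1, h2]
  exact h ▸ star_mul_self_nonneg e

theorem IsIdentityElement.eq {A : Type*} [Mul A] {e f : A} (he : IsIdentityElement e)
    (hf : IsIdentityElement f) : e = f :=
  ((hf e).2).symm.trans (he f).1

theorem IsIdentityElement.norm_le_one {A : Type*} [NonUnitalCStarAlgebra A] {e : A}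
    (he : IsIdentityElement e) : ‖e‖ ≤ 1 := by
  have h1 : ‖e‖ * ‖e‖ = ‖star e‖ := by rw [← CStarRing.norm_star_mul_self, (he _).2]
  rw [norm_star] at h1
  nlinarith [norm_nonneg e]

theorem IsIdentityElement.norm_eq_one {A : Type*} [NonUnitalCStarAlgebra A] [Nontrivial A] {e : A}
    (he : IsIdentityElement e) : ‖e‖ = 1 := by
  have h1 : ‖e‖ * ‖e‖ = ‖star e‖ := by rw [← CStarRing.norm_star_mul_self, (he _).2]
  rw [norm_star] at h1
  have h0 : ‖e‖ ≠ 0 := fun h => by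
    obtain ⟨a, ha⟩ := exists_ne (0 : A)
    exact ha (by rw [← (he a).1, norm_eq_zero.1 h, zero_mul])
  exact mul_right_cancel₀ h0 (h1.trans (one_mul _).symm)

/-! ### Improving the section -/

section Section

variable {B D : Type*} [NonUnitalCStarAlgebra B] [NonUnitalCStarAlgebra D] (π : B →⋆ₙₐ[ℂ] D)

/-- A surjective ⋆-homomorphism has a continuous section that vanishes at zero and preserves
identity elements. -/
theorem exists_continuous_section_map_zero_map_identity (hπ : Function.Surjective π) :
    ∃ s : D → B, Continuous s ∧ (∀ d, π (s d) = d) ∧ s 0 = 0 ∧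
      (Nontrivial D → ∀ (e : B) (f : D), IsIdentityElement e → IsIdentityElement f →
        π e = f → s f = e) := by
  let P : B →L[ℝ] D := LinearMap.mkContinuous
    { toFun := π
      map_add' := map_add π
      map_smul' := fun r b => by
        simpa using map_smul π (r : ℂ) b } 1 fun b => by
      simpa using NonUnitalStarAlgHom.norm_apply_le π b
  obtain ⟨t, htc, ht⟩ := exists_continuous_section P hπ
  replace ht : ∀ d, π (t d) = d := ht
  by_cases h : Nontrivial D ∧ ∃ (e : B) (f : D), IsIdentityElement e ∧ IsIdentityElement f ∧ π e = f
  · obtain ⟨hD, e, f, he, hf, hef⟩ := h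
    -- Both `t 0` and `e - (t f - t 0)` lie in the kernel of `π`; the weight `‖d‖` is 0 at 0 and 1
    -- at `f`.
    refine ⟨fun d => t d - t 0 + ‖d‖ • (e - (t f - t 0)), by fun_prop, fun d => ?_, by simp, ?_⟩
    · change P _ = d
      rw [map_add, map_smul, map_sub, map_sub, map_sub]
      change π (t d) - π (t 0) + ‖d‖ • (π e - (π (t f) - π (t 0))) = d
      simp [ht, hef]
    · intro _ e' f' he' hf' _
      beta_reduce
      rw [← he.eq he', ← hf.eq hf', hf.norm_eq_one]
      simp
  · refine ⟨fun d => t d - t 0, by fun_prop, fun d => by simp [ht], by simp, ?_⟩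
    exact fun hD e f he hf hef => (h ⟨hD, e, f, he, hf, hef⟩).elim

/-- The norm of a contractive section onto a nontrivial normed space is one. -/
theorem isLeast_one_of_contractive_section (s : D → B) (hs : ∀ d, π (s d) = d)
    (hle : ∀ d, ‖s d‖ ≤ ‖d‖) (hD : Nontrivial D) :
    IsLeast {C : ℝ | ∀ d : D, ‖s d‖ ≤ C * ‖d‖} 1 := by
  refine ⟨fun d => by simpa using hle d, fun C hC => ?_⟩
  obtain ⟨d, hd⟩ := exists_ne (0 : D)
  have h1 : ‖d‖ ≤ ‖s d‖ := by simpa [hs] using NonUnitalStarAlgHom.norm_apply_le π (s d)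
  have h2 : 1 * ‖d‖ ≤ C * ‖d‖ := by simpa using h1.trans (hC d)
  exact le_of_mul_le_mul_right h2 (norm_pos_iff.2 hd)

variable [PartialOrder B] [StarOrderedRing B] [PartialOrder D] [StarOrderedRing D]

/-- A surjective ⋆-homomorphism has a positive continuous section that preserves identity
elements. -/
theorem exists_continuous_positive_section (hπ : Function.Surjective π) :
    ∃ s : D → B, Continuous s ∧ (∀ d, π (s d) = d) ∧ (∀ d, 0 ≤ d → 0 ≤ s d) ∧
      (Nontrivial D → ∀ (e : B) (f : D), IsIdentityElement e → IsIdentityElement f →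
        π e = f → s f = e) := by
  obtain ⟨t, htc, ht, ht0, hte⟩ := exists_continuous_section_map_zero_map_identity π hπ
  have habs : Continuous (CFC.abs : D → D) := continuous_cfcAbs
  have habs' : Continuous (CFC.abs : B → B) := continuous_cfcAbs
  have key : ∀ d, 0 ≤ d → CFC.abs (t (CFC.abs d)) + t (d - CFC.abs d) = CFC.abs (t d) := by
    intro d hd
    rw [CFC.abs_of_nonneg d hd, sub_self, ht0, add_zero]
  refine ⟨fun d => CFC.abs (t (CFC.abs d)) + t (d - CFC.abs d), by fun_prop, fun d => ?_,
    fun d hd => ?_, fun hD e f he hf hef => ?_⟩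
  · simp [map_cfcAbs, ht]
  · beta_reduce
    rw [key d hd]
    exact CFC.abs_nonneg _
  · beta_reduce
    rw [key f hf.nonneg, hte hD e f he hf hef, CFC.abs_of_nonneg e he.nonneg]

/-- A surjective ⋆-homomorphism has a contractive positive continuous section that preserves
identity elements. -/
theorem exists_continuous_contractive_positive_section (hπ : Function.Surjective π) :
    ∃ s : D → B, Continuous s ∧ (∀ d, π (s d) = d) ∧ (∀ d, ‖s d‖ ≤ ‖d‖) ∧
      (∀ d, 0 ≤ d → 0 ≤ s d) ∧
      (Nontrivial D → ∀ (e : B) (f : D), IsIdentityElement e → IsIdentityElement f →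
        π e = f → s f = e) := by
  obtain ⟨t, htc, ht, htp, hte⟩ := exists_continuous_positive_section π hπ
  have hle : ∀ d, ‖‖d‖ • unitBallRetraction (‖d‖⁻¹ • t d)‖ ≤ ‖d‖ := fun d => by
    rw [norm_smul, norm_norm]
    exact mul_le_of_le_one_right (norm_nonneg d) (norm_unitBallRetraction_le _)
  have hreal : ∀ (r : ℝ) (b : B), π (r • b) = r • π b := fun r b => by
    simpa using map_smul π (r : ℂ) b
  refine ⟨fun d => ‖d‖ • unitBallRetraction (‖d‖⁻¹ • t d), ?_, fun d => ?_, hle,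
    fun d hd => ?_, fun hD e f he hf hef => ?_⟩
  · refine continuous_iff_continuousAt.2 fun d => ?_
    -- The factor `‖d‖⁻¹` is discontinuous at 0; there the bound `hle` gives continuity instead.
    by_cases hd : d = 0
    · subst hd
      rw [ContinuousAt, norm_zero, zero_smul]
      exact squeeze_zero_norm hle (by simpa using (continuous_norm (E := D)).tendsto 0)
    · have h1 : ContinuousAt (fun d : D => ‖d‖⁻¹ • t d) d :=
        (continuous_norm.continuousAt.inv₀ (norm_ne_zero_iff.2 hd)).smul htc.continuousAt
      exact continuous_norm.continuousAt.smul
        (continuous_unitBallRetraction.continuousAt.comp h1)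
  · by_cases hd : d = 0
    · simp [hd]
    · have h0 : ‖d‖ ≠ 0 := norm_ne_zero_iff.2 hd
      rw [hreal, map_unitBallRetraction, hreal, ht, unitBallRetraction_of_norm_le, smul_smul,
        mul_inv_cancel₀ h0, one_smul]
      rw [norm_smul, norm_inv, norm_norm, inv_mul_cancel₀ h0]
  · exact smul_nonneg (norm_nonneg d) (unitBallRetraction_nonneg
      (smul_nonneg (inv_nonneg.2 (norm_nonneg d)) (htp d hd)))
  · beta_reduce
    rw [hf.norm_eq_one, hte hD e f he hf hef, inv_one, one_smul, one_smul,
      unitBallRetraction_of_norm_le he.norm_le_one]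

theorem exists_isContractivePositiveSection (hπ : Function.Surjective π) :
    ∃ s : D → B, IsContractivePositiveSection π s := by
  obtain ⟨t, htc, ht, htn, htp, hte⟩ := exists_continuous_contractive_positive_section π hπ
  have hreal : ∀ (r : ℝ) (b : B), π (r • b) = r • π b := fun r b => by
    simpa using map_smul π (r : ℂ) b
  let s : D → B := fun d => (2⁻¹ : ℝ) • (t d + star (t (star d)))
  have hs : ∀ d, π (s d) = d := fun d => by
    simp only [s, hreal, map_add, map_star, ht, star_star, ← two_smul ℝ d, smul_smul]
    simp
  have hsn : ∀ d, ‖s d‖ ≤ ‖d‖ := fun d => by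
    have h1 := norm_add_le (t d) (star (t (star d)))
    have h2 := htn (star d)
    rw [norm_star] at h1 h2
    simp only [s, norm_smul, norm_inv, Real.norm_ofNat]
    linarith [htn d]
  -- Symmetrizing changes nothing on positive elements, so positivity and the unit survive.
  have hsp : ∀ d, 0 ≤ d → s d = t d := fun d hd => by
    simp only [s]
    rw [(IsSelfAdjoint.of_nonneg hd).star_eq, (IsSelfAdjoint.of_nonneg (htp d hd)).star_eq,
      ← two_smul ℝ, smul_smul]
    simp
  exact ⟨s,
    { isSection := hs
      continuous := by fun_prop
      contractive := hsn
      norm_eq_one := isLeast_one_of_contractive_section π s hs hsn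
      unital := fun hD e f he hf hef => by rw [hsp f hf.nonneg, hte hD e f he hf hef]
      selfadjoint := fun d => by simp [s, add_comm]
      positive := fun d hd => by rw [hsp d hd]; exact htp d hd }⟩

end Section

/-! ### Averaging over a compact group -/

section Average

open MeasureTheory

variable {G A : Type*} [Group G] [NonUnitalCStarAlgebra A]

theorem norm_starAlgEquiv_apply_le (φ : A ≃⋆ₐ[ℂ] A) (a : A) : ‖φ a‖ ≤ ‖a‖ :=
  NonUnitalStarAlgHom.norm_apply_le φ a

theorem starAlgEquiv_continuous (φ : A ≃⋆ₐ[ℂ] A) : Continuous φ :=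
  AddMonoidHomClass.continuous_of_bound φ 1 fun a => by
    simpa using norm_starAlgEquiv_apply_le φ a

theorem starAlgEquiv_nonneg [PartialOrder A] [StarOrderedRing A] (φ : A ≃⋆ₐ[ℂ] A) {a : A}
    (ha : 0 ≤ a) : 0 ≤ φ a := by
  obtain ⟨b, rfl⟩ := CStarAlgebra.nonneg_iff_eq_star_mul_self.1 ha
  rw [map_mul, map_star]
  exact star_mul_self_nonneg _

theorem starAlgEquiv_identity (φ : A ≃⋆ₐ[ℂ] A) {e : A} (he : IsIdentityElement e) : φ e = e := by
  refine IsIdentityElement.eq (fun a => ?_) he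
  have h := he (φ.symm a)
  constructor
  · simpa using congrArg φ h.1
  · simpa using congrArg φ h.2

/-- Automorphisms are contractive, so continuity of orbit maps suffices even when the vector varies
with `g`. -/
theorem IsGAlgebraAction.continuous_apply [TopologicalSpace G] {α : G →* (A ≃⋆ₐ[ℂ] A)}
    (hα : IsGAlgebraAction α) {u : G → A} (hu : Continuous u) : Continuous fun g => α g (u g) := by
  refine continuous_iff_continuousAt.2 fun g₀ => tendsto_iff_norm_sub_tendsto_zero.2 ?_
  have h1 : Tendsto (fun g => ‖u g - u g₀‖) (𝓝 g₀) (𝓝 0) :=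
    tendsto_iff_norm_sub_tendsto_zero.1 (hu.tendsto g₀)
  have h2 : Tendsto (fun g => ‖α g (u g₀) - α g₀ (u g₀)‖) (𝓝 g₀) (𝓝 0) :=
    tendsto_iff_norm_sub_tendsto_zero.1 ((hα (u g₀)).tendsto g₀)
  refine squeeze_zero (fun _ => norm_nonneg _) (fun g => ?_) (by simpa using h1.add h2)
  calc ‖α g (u g) - α g₀ (u g₀)‖
      = ‖α g (u g - u g₀) + (α g (u g₀) - α g₀ (u g₀))‖ := by rw [map_sub]; abel_nf
    _ ≤ ‖α g (u g - u g₀)‖ + ‖α g (u g₀) - α g₀ (u g₀)‖ := norm_add_le _ _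
    _ ≤ _ := by gcongr; exact norm_starAlgEquiv_apply_le _ _

/-- Averaging a contractive positive section over a compact group makes it equivariant. -/
theorem IsContractivePositiveSection.exists_equivariant {B D : Type*}
    [NonUnitalCStarAlgebra B] [PartialOrder B] [StarOrderedRing B]
    [NonUnitalCStarAlgebra D] [PartialOrder D] [StarOrderedRing D]
    {π : B →⋆ₙₐ[ℂ] D} {t : D → B} (ht : IsContractivePositiveSection π t)
    [TopologicalSpace G] [IsTopologicalGroup G] [CompactSpace G]
    {α : G →* (B ≃⋆ₐ[ℂ] B)} {β : G →* (D ≃⋆ₐ[ℂ] D)}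
    (hα : IsGAlgebraAction α) (hβ : IsGAlgebraAction β)
    (hπ : ∀ (g : G) (b : B), π (α g b) = β g (π b)) :
    ∃ s : D → B, IsContractivePositiveSection π s ∧
      ∀ (g : G) (d : D), s (β g d) = α g (s d) := by
  let : MeasurableSpace G := borel G
  have : BorelSpace G := ⟨rfl⟩
  -- Normalizing on the whole group gives total mass 1.
  let μ : Measure G := Measure.haarMeasure ⊤
  have : IsProbabilityMeasure μ := ⟨Measure.haarMeasure_self⟩
  let F : D → G → B := fun d g => α g (t (β g⁻¹ d))
  have hFc : ∀ d, Continuous (F d) := fun d =>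
    hα.continuous_apply (ht.continuous.comp ((hβ d).comp continuous_inv))
  have hFi : ∀ d, Integrable (F d) μ := fun d =>
    (hFc d).integrable_of_hasCompactSupport (HasCompactSupport.of_compactSpace _)
  have hFn : ∀ d g, ‖F d g‖ ≤ ‖d‖ := fun d g =>
    (norm_starAlgEquiv_apply_le _ _).trans
      ((ht.contractive _).trans (norm_starAlgEquiv_apply_le _ _))
  have hβi : ∀ g d, β g (β g⁻¹ d) = d := fun g d => by
    change (β g * β g⁻¹) d = d
    rw [← map_mul]; simp
  have hπF : ∀ d g, π (F d g) = d := fun d g => by simp only [F, hπ, ht.isSection, hβi]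
  let s : D → B := fun d => ∫ g, F d g ∂μ
  have hπc : Continuous π := AddMonoidHomClass.continuous_of_bound π 1 fun a => by
    simpa using NonUnitalStarAlgHom.norm_apply_le π a
  have hs : ∀ d, π (s d) = d := fun d => by
    let P : B →L[ℂ] D := ⟨(π : B →ₗ[ℂ] D), hπc⟩
    have h := P.integral_comp_comm (hFi d)
    change ∫ g, π (F d g) ∂μ = π (s d) at h
    rw [← h]
    simp [hπF]
  have hsn : ∀ d, ‖s d‖ ≤ ‖d‖ := fun d => by
    simpa using norm_integral_le_of_norm_le_const (μ := μ) (Eventually.of_forall (hFn d))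
  refine ⟨s,
    { isSection := hs
      continuous := ?_
      contractive := hsn
      norm_eq_one := isLeast_one_of_contractive_section π s hs hsn
      unital := fun hD e f he hf hef => ?_
      selfadjoint := fun d => ?_
      positive := fun d hd => ?_ }, fun h d => ?_⟩
  · refine continuous_iff_continuousAt.2 fun d₀ => ?_
    refine continuousAt_of_dominated (bound := fun _ => ‖d₀‖ + 1)
      (Eventually.of_forall fun d => (hFi d).aestronglyMeasurable) ?_ (integrable_const _)
      (Eventually.of_forall fun g => ?_)
    · have : ∀ᶠ d in 𝓝 d₀, ‖d‖ < ‖d₀‖ + 1 :=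
        continuous_norm.continuousAt.eventually_lt continuousAt_const (by simp)
      filter_upwards [this] with d hd
      exact Eventually.of_forall fun g => (hFn d g).trans hd.le
    · exact ((starAlgEquiv_continuous (α g)).comp
        (ht.continuous.comp (starAlgEquiv_continuous (β g⁻¹)))).continuousAt
  · have : ∀ g, F f g = e := fun g => by
      simp only [F, starAlgEquiv_identity _ hf, ht.unital hD e f he hf hef,
        starAlgEquiv_identity _ he]
    simp [s, this]
  · have h := (starL' ℝ (A := B)).toContinuousLinearMap.integral_comp_comm (hFi d)
    change ∫ g, star (F d g) ∂μ = star (s d) at h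
    rw [← h]
    refine integral_congr_ae (Eventually.of_forall fun g => ?_)
    simp only [F, map_star, ht.selfadjoint]
  · exact integral_nonneg fun g =>
      starAlgEquiv_nonneg _ (ht.positive _ (starAlgEquiv_nonneg _ hd))
  · let Q : B →L[ℂ] B := ⟨((α h : B ≃⋆ₐ[ℂ] B) : B →ₗ[ℂ] B), starAlgEquiv_continuous (α h)⟩
    have h1 := Q.integral_comp_comm (hFi d)
    change ∫ g, α h (F d g) ∂μ = α h (s d) at h1
    rw [← h1]
    change ∫ g, F (β h d) g ∂μ = _
    -- Substituting `h * g` for `g` turns the integrand into `α h (F d g)`.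
    rw [← integral_mul_left_eq_self (F (β h d)) h]
    refine integral_congr_ae (Eventually.of_forall fun g => ?_)
    have h2 : β (h * g)⁻¹ (β h d) = β g⁻¹ d := by
      change (β (h * g)⁻¹ * β h) d = _
      rw [← map_mul]; simp
    simp only [F, h2, map_mul]
    rfl

end Average

theorem theorem3p3 {B D : Type*}
    [NonUnitalCStarAlgebra B] [PartialOrder B] [StarOrderedRing B]
    [NonUnitalCStarAlgebra D] [PartialOrder D] [StarOrderedRing D]
    (π : B →⋆ₙₐ[ℂ] D) (hπ : Function.Surjective π) :
    (∃ s : D → B, IsContractivePositiveSection π s) ∧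
    (∀ (G : Type*) [Group G] [TopologicalSpace G] [IsTopologicalGroup G] [CompactSpace G]
      (α : G →* (B ≃⋆ₐ[ℂ] B)) (β : G →* (D ≃⋆ₐ[ℂ] D)),
      IsGAlgebraAction α → IsGAlgebraAction β →
      (∀ (g : G) (b : B), π (α g b) = β g (π b)) →
      ∃ s : D → B, IsContractivePositiveSection π s ∧
        ∀ (g : G) (d : D), s (β g d) = α g (s d)) := by
  obtain ⟨t, ht⟩ := exists_isContractivePositiveSection π hπ
  exact ⟨⟨t, ht⟩, fun G _ _ _ _ α β hα hβ h => ht.exists_equivariant hα hβ h⟩
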